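/- Let $P$ be a finite graded poset with rank function $\mathrm{rk}:P\to\mathbb N$ (so $x\lessdot y$ implies $\mathrm{rk}(y)=\mathrm{rk}(x)+1$) that is thin: every closed interval $[x,y]$ with $x\le y$ and $\mathrm{rk}(y)=\mathrm{rk}(x)+2$ has exactly four elements; such an interval is called a diamond. The diamond space $X(P)$ is the regular CW complex whose $0$-cells are the elements of $P$, which has one $1$-cell joining $x$ and $y$ for each cover relation $x\lessdot y$, and one $2$-cell for each diamond $\{x,a,b,y\}$ (with $x\lessdot a\lessdot y$, $x\lessdot b\lessdot y$), glued in along the circle formed by its four edges $xa$, $ay$, $xb$, $by$. Let $Z$ be a (Hausdorff) regular CW complex whose $2$-skeleton is isomorphic to $X(P)$ as a CW complex, that is, by a homeomorphism that carries the open cells of each dimension bijectively to the open cells of the same dimension. For a cell $e$ of $Z$, its faces are the cells whose closure is contained in the closure of $e$. Suppose that every $3$-cell of $Z$ has an even number of $2$-dimensional faces, and that $H^2(Z;\mathbb Z/2)=0$. Here $H^*(Z;\mathbb Z/2)$ is cellular cohomology: the cohomology of the complex of $\mathbb Z/2$-valued functions on the cells of $Z$, where $(\delta\psi)(e)$ is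 the sum of $\psi(f)$ over the codimension-one faces $f$ of $e$. Then $P$ is balanced colorable: there is a function $c$ from the set of cover relations of $P$ to $\{1,-1\}$ such that for every diamond $[x,y]$ of $P$, the number of cover relations $u\lessdot v$ with $x\le u$, $v\le y$ and $c(u\lessdot v)=-1$ is odd. -/

import Mathlib

open Set Topology

universe u v

/-! ### Thin posets and balanced colorings -/

/-- A graded poset is *thin* if every closed interval of length two has exactly four elements.
(The grading is Mathlib's `GradeOrder ℕ P`: a rank function for which cover relations raise the
rank by exactly one.) -/
class IsThin (P : Type u) [PartialOrder P] [GradeOrder ℕ P] : Prop where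
  ncard_Icc : ∀ x y : P, x ≤ y → grade ℕ y = grade ℕ x + 2 → (Icc x y).ncard = 4

/-- The cover relations of a poset, i.e. the edges of its Hasse diagram. -/
def CoverRel (P : Type u) [PartialOrder P] : Type u :=
  {p : P × P // p.1 ⋖ p.2}

/-- The diamonds of a thin poset: the (nonempty, closed) intervals of length two, each recorded by
its least and its greatest element. -/
def Diamond (P : Type u) [PartialOrder P] [GradeOrder ℕ P] : Type u :=
  {p : P × P // p.1 ≤ p.2 ∧ grade ℕ p.2 = grade ℕ p.1 + 2}

/-- A `±1`-coloring of the cover relations is *balanced* if every diamond has an odd number of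
edges colored `-1`. -/
def IsBalancedColoring (P : Type u) [PartialOrder P] [GradeOrder ℕ P]
    (c : CoverRel P → ℤˣ) : Prop :=
  ∀ d : Diamond P,
    Odd {e : CoverRel P | d.1.1 ≤ e.1.1 ∧ e.1.2 ≤ d.1.2 ∧ c e = -1}.ncard

/-! ### The diamond space of a thin poset -/

namespace DiamondSpace

section Corners

variable {P : Type u} [PartialOrder P] [GradeOrder ℕ P]

theorem covBy_of_grade {x y : P} (h : x < y) (hg : grade ℕ y = grade ℕ x + 1) : x ⋖ y := by
  refine ⟨h, fun z hxz hzy => ?_⟩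
  have h1 := grade_strictMono (𝕆 := ℕ) hxz
  have h2 := grade_strictMono (𝕆 := ℕ) hzy
  omega

/-- A diamond of a thin poset has two elements besides its least and its greatest one. -/
theorem exists_corners [IsThin P] (d : Diamond P) :
    ∃ ab : P × P, ab.1 ≠ ab.2 ∧ d.1.1 ⋖ ab.1 ∧ ab.1 ⋖ d.1.2 ∧ d.1.1 ⋖ ab.2 ∧ ab.2 ⋖ d.1.2 := by
  obtain ⟨⟨x, y⟩, hle, hg⟩ := d
  dsimp only at hle hg ⊢
  have hne : x ≠ y := by rintro rfl; omega
  have h4 := IsThin.ncard_Icc x y hle hg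
  have hfin : (Icc x y).Finite := finite_of_ncard_pos (by omega)
  have h2 : ((Icc x y) \ {x, y}).ncard = 2 := by
    have := ncard_sdiff (s := {x, y}) (t := Icc x y)
      (by rintro z (rfl | rfl) <;> simp [hle]) (by simp)
    rw [this, h4, ncard_pair hne]
  obtain ⟨a, b, hab, hs⟩ := ncard_eq_two.1 h2
  have key : ∀ z ∈ (Icc x y) \ {x, y}, x ⋖ z ∧ z ⋖ y := by
    rintro z ⟨⟨h1, h2⟩, h3⟩
    have hx : x < z := lt_of_le_of_ne h1 (by rintro rfl; simp at h3)
    have hy : z < y := lt_of_le_of_ne h2 (by rintro rfl; simp at h3)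
    have g1 := grade_strictMono (𝕆 := ℕ) hx
    have g2 := grade_strictMono (𝕆 := ℕ) hy
    exact ⟨covBy_of_grade hx (by omega), covBy_of_grade hy (by omega)⟩
  have ha := key a (by rw [hs]; simp)
  have hb := key b (by rw [hs]; simp)
  exact ⟨(a, b), hab, ha.1, ha.2, hb.1, hb.2⟩

end Corners

noncomputable section

variable (P : Type u) [PartialOrder P] [GradeOrder ℕ P]

/-- The cells of the diamond space: one `0`-cell for each element, one `1`-cell for each cover
relation, one `2`-cell for each diamond. -/
def Cell : ℕ → Type u
  | 0 => P
  | 1 => CoverRel P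
  | 2 => Diamond P
  | _ + 3 => PEmpty

variable {P}

/-- The least element of a cell. -/
def bot : (n : ℕ) → Cell P n → P
  | 0, x => x
  | 1, e => e.1.1
  | 2, d => d.1.1
  | _ + 3, i => i.elim

/-- The greatest element of a cell. -/
def top : (n : ℕ) → Cell P n → P
  | 0, x => x
  | 1, e => e.1.2
  | 2, d => d.1.2
  | _ + 3, i => i.elim

theorem grade_top (n : ℕ) (i : Cell P n) : grade ℕ (top n i) = grade ℕ (bot n i) + n := by
  match n, i with
  | 0, i => rfl
  | 1, e => exact (Nat.covBy_iff_add_one_eq.1 (e.2.grade ℕ)).symm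
  | 2, d => exact d.2.2
  | _ + 3, i => exact i.elim

theorem cell_ext (n m : ℕ) (i : Cell P n) (j : Cell P m) (hb : bot n i = bot m j)
    (ht : top n i = top m j) : (⟨n, i⟩ : Σ n, Cell P n) = ⟨m, j⟩ := by
  have h1 := grade_top n i
  have h2 := grade_top m j
  rw [hb, ht, h2] at h1
  obtain rfl : n = m := by omega
  congr 1
  match n, i, j with
  | 0, i, j => exact hb
  | 1, e, f => exact Subtype.ext (Prod.ext hb ht)
  | 2, d, f => exact Subtype.ext (Prod.ext hb ht)
  | _ + 3, i, _ => exact i.elim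

/-- The two middle elements of a diamond, in some order. -/
def corners [IsThin P] (d : Diamond P) : P × P := (exists_corners d).choose

theorem corners_spec [IsThin P] (d : Diamond P) :
    (corners d).1 ≠ (corners d).2 ∧ d.1.1 ⋖ (corners d).1 ∧ (corners d).1 ⋖ d.1.2 ∧
      d.1.1 ⋖ (corners d).2 ∧ (corners d).2 ⋖ d.1.2 :=
  (exists_corners d).choose_spec

open scoped Classical in
/-- The standard basis vector of `ℝ^P` at `x`. -/
def vertexPt (x : P) : P → ℝ := Pi.single x 1

/-- The point of the segment from `x` to `y` with parameter `s ∈ [-1, 1]`. -/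
def edgePt (x y : P) (s : ℝ) : P → ℝ :=
  ((1 - s) / 2) • vertexPt x + ((1 + s) / 2) • vertexPt y

/-- The bilinear square in `ℝ^P` with corners `x, a, b, y`; its boundary consists of the four
segments `xa`, `xb`, `ay`, `by`. -/
def squarePt (x a b y : P) (s t : ℝ) : P → ℝ :=
  ((1 - t) / 2) • edgePt x a s + ((1 + t) / 2) • edgePt b y s

variable [IsThin P]

/-- The characteristic maps of the diamond space, on all of `ℝⁿ`: a `0`-cell is the basis vector,
a `1`-cell the segment between the two basis vectors, a `2`-cell the square that fills in the
diamond. -/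
def cellFun : (n : ℕ) → Cell P n → (Fin n → ℝ) → (P → ℝ)
  | 0, x => fun _ => vertexPt (P := P) x
  | 1, e => fun w => edgePt e.1.1 e.1.2 (w 0)
  | 2, d => fun w => squarePt d.1.1 (corners d).1 (corners d).2 d.1.2 (w 0) (w 1)
  | _ + 3, i => i.elim

/-- Left inverses of the characteristic maps. -/
def cellInv : (n : ℕ) → Cell P n → (P → ℝ) → (Fin n → ℝ)
  | 0, _ => fun _ => ![]
  | 1, e => fun v => ![2 * v e.1.2 - 1]
  | 2, d => fun v => ![2 * (v (corners d).1 + v d.1.2) - 1, 2 * (v (corners d).2 + v d.1.2) - 1]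
  | _ + 3, i => i.elim

theorem cellInv_cellFun (n : ℕ) (i : Cell P n) (w : Fin n → ℝ) :
    cellInv n i (cellFun n i w) = w := by
  match n, i with
  | 0, i => exact Subsingleton.elim _ _
  | 1, e =>
    have h : e.1.2 ≠ e.1.1 := e.2.lt.ne'
    ext k
    fin_cases k
    simp [cellFun, cellInv, edgePt, vertexPt, h]
    ring
  | 2, d =>
    obtain ⟨h0, h1, h2, h3, h4⟩ := corners_spec d
    have h5 := h1.lt.trans h2.lt
    ext k
    fin_cases k
    · simp [cellFun, cellInv, squarePt, edgePt, vertexPt, h0, h1.lt.ne', h2.lt.ne, h2.lt.ne',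
        h4.lt.ne', h5.ne']
      ring
    · simp [cellFun, cellInv, squarePt, edgePt, vertexPt, h0.symm, h3.lt.ne', h4.lt.ne, h2.lt.ne',
        h4.lt.ne', h5.ne']
      ring
  | _ + 3, i => exact i.elim

theorem continuous_cellFun (n : ℕ) (i : Cell P n) : Continuous (cellFun n i) := by
  match n, i with
  | 0, i => exact continuous_const
  | 1, e => simp only [cellFun, edgePt]; fun_prop
  | 2, d => simp only [cellFun, squarePt, edgePt]; fun_prop
  | _ + 3, i => exact i.elim

theorem continuous_cellInv (n : ℕ) (i : Cell P n) : Continuous (cellInv n i) := by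
  match n, i with
  | 0, i => exact continuous_const
  | 1, e => simp only [cellInv]; fun_prop
  | 2, d => simp only [cellInv]; fun_prop
  | _ + 3, i => exact i.elim

theorem cellFun_bot_ne_zero (n : ℕ) (i : Cell P n) (w : Fin n → ℝ)
    (hw : w ∈ Metric.ball 0 1) : cellFun n i w (bot n i) ≠ 0 := by
  rw [mem_ball_zero_iff, pi_norm_lt_iff one_pos] at hw
  match n, i with
  | 0, i =>
    have h : vertexPt (P := P) i i = 1 := by classical exact Pi.single_eq_same _ _
    exact h.trans_ne one_ne_zero
  | 1, e =>
    have h : e.1.1 < e.1.2 := e.2.lt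
    have hw0 := abs_lt.1 (hw 0)
    have h1 : 0 < (1 - w 0) / 2 := by linarith
    simpa [cellFun, bot, edgePt, vertexPt, h.ne] using h1.ne'
  | 2, d =>
    obtain ⟨h0, h1, h2, h3, h4⟩ := corners_spec d
    have h5 := h1.lt.trans h2.lt
    have hw0 := abs_lt.1 (hw 0)
    have hw1 := abs_lt.1 (hw 1)
    have h6 : 0 < (1 - w 1) / 2 * ((1 - w 0) / 2) := by
      apply mul_pos <;> linarith
    simpa [cellFun, bot, squarePt, edgePt, vertexPt, h1.lt.ne, h3.lt.ne, h5.ne] using h6.ne'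
  | _ + 3, i => exact i.elim

theorem cellFun_top_ne_zero (n : ℕ) (i : Cell P n) (w : Fin n → ℝ)
    (hw : w ∈ Metric.ball 0 1) : cellFun n i w (top n i) ≠ 0 := by
  rw [mem_ball_zero_iff, pi_norm_lt_iff one_pos] at hw
  match n, i with
  | 0, i =>
    have h : vertexPt (P := P) i i = 1 := by classical exact Pi.single_eq_same _ _
    exact h.trans_ne one_ne_zero
  | 1, e =>
    have h : e.1.1 < e.1.2 := e.2.lt
    have hw0 := abs_lt.1 (hw 0)
    have h1 : 0 < (1 + w 0) / 2 := by linarith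
    simpa [cellFun, top, edgePt, vertexPt, h.ne'] using h1.ne'
  | 2, d =>
    obtain ⟨h0, h1, h2, h3, h4⟩ := corners_spec d
    have h5 := h1.lt.trans h2.lt
    have hw0 := abs_lt.1 (hw 0)
    have hw1 := abs_lt.1 (hw 1)
    have h6 : 0 < (1 + w 1) / 2 * ((1 + w 0) / 2) := by
      apply mul_pos <;> linarith
    simpa [cellFun, top, squarePt, edgePt, vertexPt, h2.lt.ne', h4.lt.ne', h5.ne'] using h6.ne'
  | _ + 3, i => exact i.elim

theorem bot_le_and_le_top (n : ℕ) (i : Cell P n) (w : Fin n → ℝ) (p : P)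
    (hp : cellFun n i w p ≠ 0) : bot n i ≤ p ∧ p ≤ top n i := by
  match n, i with
  | 0, i =>
    have : p = i := by
      by_contra h
      change vertexPt (P := P) i p ≠ 0 at hp
      exact hp (by classical exact Pi.single_eq_of_ne h 1)
    exact ⟨this.ge, this.le⟩
  | 1, e =>
    have h : e.1.1 ≤ e.1.2 := e.2.lt.le
    by_cases h1 : p = e.1.1
    · subst h1; exact ⟨le_rfl, h⟩
    by_cases h2 : p = e.1.2
    · subst h2; exact ⟨h, le_rfl⟩
    simp [cellFun, edgePt, vertexPt, h1, h2] at hp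
  | 2, d =>
    obtain ⟨h0, h1, h2, h3, h4⟩ := corners_spec d
    have h5 := h1.le.trans h2.le
    by_cases e1 : p = d.1.1
    · subst e1; exact ⟨le_rfl, h5⟩
    by_cases e2 : p = d.1.2
    · subst e2; exact ⟨h5, le_rfl⟩
    by_cases e3 : p = (corners d).1
    · subst e3; exact ⟨h1.le, h2.le⟩
    by_cases e4 : p = (corners d).2
    · subst e4; exact ⟨h3.le, h4.le⟩
    simp [cellFun, squarePt, edgePt, vertexPt, e1, e2, e3, e4] at hp
  | _ + 3, i => exact i.elim

theorem disjoint_of_ne (n m : ℕ) (i : Cell P n) (j : Cell P m)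
    (h : (⟨n, i⟩ : Σ n, Cell P n) ≠ ⟨m, j⟩) :
    Disjoint (cellFun n i '' Metric.ball 0 1) (cellFun m j '' Metric.ball 0 1) := by
  rw [Set.disjoint_left]
  rintro _ ⟨w, hw, rfl⟩ ⟨w', hw', he⟩
  refine h (cell_ext n m i j (le_antisymm ?_ ?_) (le_antisymm ?_ ?_))
  · exact (bot_le_and_le_top n i w _ (he ▸ cellFun_bot_ne_zero m j w' hw')).1
  · exact (bot_le_and_le_top m j w' _ (he ▸ cellFun_bot_ne_zero n i w hw)).1
  · exact (bot_le_and_le_top m j w' _ (he ▸ cellFun_top_ne_zero n i w hw)).2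
  · exact (bot_le_and_le_top n i w _ (he ▸ cellFun_top_ne_zero m j w' hw')).2

theorem mapsTo_sphere (n : ℕ) (i : Cell P n) :
    MapsTo (cellFun n i) (Metric.sphere 0 1)
      (⋃ (m < n) (j : Cell P m), cellFun m j '' Metric.closedBall 0 1) := by
  intro w hw
  simp only [mem_iUnion]
  match n, i with
  | 0, i =>
    rw [mem_sphere_zero_iff_norm] at hw
    rw [Subsingleton.elim w 0, norm_zero] at hw
    exact absurd hw zero_ne_one
  | 1, e =>
    have h1 : |w 0| = 1 := by
      rw [mem_sphere_zero_iff_norm] at hw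
      rw [← hw]
      simp [Pi.norm_def]
    rcases eq_or_eq_neg_of_abs_eq h1 with h1 | h1
    · refine ⟨0, by omega, e.1.2, 0, by simp, ?_⟩
      simp [cellFun, edgePt, h1]
    · refine ⟨0, by omega, e.1.1, 0, by simp, ?_⟩
      simp [cellFun, edgePt, h1]
  | 2, d =>
    obtain ⟨-, c1, c2, c3, c4⟩ := corners_spec d
    have hb : ∀ k, |w k| ≤ 1 := by
      rw [mem_sphere_zero_iff_norm] at hw
      exact fun k => hw ▸ norm_le_pi_norm w k
    have hmem : ∀ k, (fun _ => w k : Fin 1 → ℝ) ∈ Metric.closedBall (0 : Fin 1 → ℝ) 1 := by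
      intro k
      rw [mem_closedBall_zero_iff, pi_norm_le_iff_of_nonneg zero_le_one]
      exact fun _ => hb k
    have h1 : |w 0| = 1 ∨ |w 1| = 1 := by
      by_contra! h
      have : ‖w‖ < 1 := by
        rw [pi_norm_lt_iff one_pos, Fin.forall_fin_two]
        exact ⟨lt_of_le_of_ne (hb 0) h.1, lt_of_le_of_ne (hb 1) h.2⟩
      rw [mem_sphere_zero_iff_norm] at hw
      linarith
    rcases h1 with h1 | h1 <;> rcases eq_or_eq_neg_of_abs_eq h1 with h1 | h1
    · exact ⟨1, by omega, ⟨((corners d).1, d.1.2), c2⟩, _, hmem 1, by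
        simp [cellFun, squarePt, edgePt, h1]⟩
    · exact ⟨1, by omega, ⟨(d.1.1, (corners d).2), c3⟩, _, hmem 1, by
        simp [cellFun, squarePt, edgePt, h1]⟩
    · exact ⟨1, by omega, ⟨((corners d).2, d.1.2), c4⟩, _, hmem 0, by
        simp [cellFun, squarePt, edgePt, h1]⟩
    · exact ⟨1, by omega, ⟨(d.1.1, (corners d).1), c1⟩, _, hmem 0, by
        simp [cellFun, squarePt, edgePt, h1]⟩
  | _ + 3, i => exact i.elim

/-- The characteristic maps, restricted to the open unit cubes. -/
def cellMap (n : ℕ) (i : Cell P n) : PartialEquiv (Fin n → ℝ) (P → ℝ) where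
  toFun := cellFun n i
  invFun := cellInv n i
  source := Metric.ball 0 1
  target := cellFun n i '' Metric.ball 0 1
  map_source' := fun _ hw => mem_image_of_mem _ hw
  map_target' := by rintro _ ⟨w, hw, rfl⟩; rwa [cellInv_cellFun]
  left_inv' := fun w _ => cellInv_cellFun n i w
  right_inv' := by rintro _ ⟨w, -, rfl⟩; rw [cellInv_cellFun]

end

end DiamondSpace

/-- The *diamond space* of a thin poset `P`, realized in `ℝ^P` as the union of its closed cells:
the elements of `P` (standard basis vectors), the Hasse diagram of `P` (segments), and a square
glued into each diamond along the four edges of the diamond. -/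
def diamondSpace (P : Type u) [PartialOrder P] [GradeOrder ℕ P] [IsThin P] : Set (P → ℝ) :=
  ⋃ (n : ℕ) (i : DiamondSpace.Cell P n), DiamondSpace.cellFun n i '' Metric.closedBall 0 1

/-- The CW structure of the diamond space. -/
noncomputable instance DiamondSpace.instCWComplex (P : Type u) [PartialOrder P] [Finite P]
    [GradeOrder ℕ P] [IsThin P] : CWComplex (diamondSpace P) :=
  CWComplex.mkFinite (diamondSpace P) (DiamondSpace.Cell P) DiamondSpace.cellMap
    (Filter.eventually_atTop.2 ⟨3, fun n hn => by
      obtain ⟨k, rfl⟩ := Nat.exists_eq_add_of_le' hn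
      exact inferInstanceAs (IsEmpty PEmpty)⟩)
    (fun n => match n with
      | 0 => inferInstanceAs (Finite P)
      | 1 => inferInstanceAs (Finite {p : P × P // p.1 ⋖ p.2})
      | 2 => inferInstanceAs
          (Finite {p : P × P // p.1 ≤ p.2 ∧ grade ℕ p.2 = grade ℕ p.1 + 2})
      | _ + 3 => inferInstanceAs (Finite PEmpty))
    (fun _ _ => rfl)
    (fun n i => (DiamondSpace.continuous_cellFun n i).continuousOn)
    (fun n i => (DiamondSpace.continuous_cellInv n i).continuousOn)
    (fun a _ b _ h => DiamondSpace.disjoint_of_ne a.1 b.1 a.2 b.2 h)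
    DiamondSpace.mapsTo_sphere
    rfl

/-! ### Regular CW complexes, their mod 2 cohomology, and isomorphisms between them -/

namespace RegularCW

/-- A CW complex in a Hausdorff space is *regular* if every characteristic map is injective on the
closed ball, that is, a homeomorphism onto the closed cell. -/
def IsRegular {X : Type u} [TopologicalSpace X] (C : Set X) [CWComplex C] : Prop :=
  ∀ (n : ℕ) (i : RelCWComplex.cell C n), InjOn (RelCWComplex.map n i) (Metric.closedBall 0 1)

/-- `f` is a face of `e`: the closed cell `f` is contained in the closed cell `e`. -/
def IsFace {X : Type u} [TopologicalSpace X] {C : Set X} [CWComplex C] {m n : ℕ}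
    (f : RelCWComplex.cell C m) (e : RelCWComplex.cell C n) : Prop :=
  RelCWComplex.closedCell m f ⊆ RelCWComplex.closedCell n e

/-- The set of `m`-dimensional faces of the `n`-cell `e`. -/
def faces {X : Type u} [TopologicalSpace X] {C : Set X} [CWComplex C] {n : ℕ} (m : ℕ)
    (e : RelCWComplex.cell C n) : Set (RelCWComplex.cell C m) :=
  {f | IsFace f e}

theorem finite_faces {X : Type u} [TopologicalSpace X] {C : Set X} [CWComplex C] {n : ℕ} (m : ℕ)
    (e : RelCWComplex.cell C n) : (faces m e).Finite := by
  obtain ⟨I, hI⟩ := CWComplex.cellFrontier_subset_finite_openCell n e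
  have h : Set.Finite ((Sigma.mk m) ⁻¹' ({⟨n, e⟩} ∪ ⋃ k ∈ Set.Iio n,
      Sigma.mk k '' (I k : Set (RelCWComplex.cell C k)))) := by
    refine Set.Finite.preimage sigma_mk_injective.injOn ?_
    refine (finite_singleton _).union ((finite_Iio n).biUnion fun k _ => ?_)
    exact (I k).finite_toSet.image _
  refine h.subset fun f hf => ?_
  have hp := hf (CWComplex.openCell_subset_closedCell m f (CWComplex.map_zero_mem_openCell m f))
  have hp0 := CWComplex.map_zero_mem_openCell (C := C) m f
  have key : ∀ (k : ℕ) (j : RelCWComplex.cell C k),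
      RelCWComplex.map m f 0 ∈ RelCWComplex.openCell k j →
      (⟨m, f⟩ : Σ k, RelCWComplex.cell C k) = ⟨k, j⟩ := by
    intro k j hj
    by_contra hne
    exact Set.disjoint_left.1 (CWComplex.disjoint_openCell_of_ne hne) hp0 hj
  rw [← CWComplex.cellFrontier_union_openCell_eq_closedCell] at hp
  rcases hp with hp | hp
  · have := hI hp
    simp only [mem_iUnion] at this
    obtain ⟨k, hk, j, hj, hm⟩ := this
    refine Or.inr ?_
    simp only [mem_iUnion]
    exact ⟨k, hk, j, hj, (key k j hm).symm⟩
  · exact Or.inl (key n e hp)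

/-- The mod 2 cellular coboundary of a regular CW complex. Incidence numbers in a regular complex
are `±1` for faces and `0` otherwise, so modulo 2 the value on a cell is the sum of the values on
its faces of codimension one. -/
noncomputable def coboundary {X : Type u} [TopologicalSpace X] (C : Set X) [CWComplex C] (n : ℕ) :
    (RelCWComplex.cell C n → ZMod 2) →ₗ[ZMod 2] (RelCWComplex.cell C (n + 1) → ZMod 2) where
  toFun ψ := fun e => ∑ f ∈ (finite_faces n e).toFinset, ψ f
  map_add' ψ χ := by ext e; simp [Finset.sum_add_distrib]
  map_smul' a ψ := by ext e; simp [Finset.mul_sum]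

/-- The `n`-cocycles with coefficients in `ℤ/2`. -/
noncomputable def cocycles {X : Type u} [TopologicalSpace X] (C : Set X) [CWComplex C] (n : ℕ) :
    Submodule (ZMod 2) (RelCWComplex.cell C n → ZMod 2) :=
  LinearMap.ker (coboundary C n)

/-- The `n`-coboundaries with coefficients in `ℤ/2`. -/
noncomputable def coboundaries {X : Type u} [TopologicalSpace X] (C : Set X) [CWComplex C] :
    (n : ℕ) → Submodule (ZMod 2) (RelCWComplex.cell C n → ZMod 2)
  | 0 => ⊥
  | n + 1 => LinearMap.range (coboundary C n)

/-- The cohomology `Hⁿ(C; ℤ/2)` of a regular CW complex: cocycles modulo coboundaries. -/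
abbrev Cohomology {X : Type u} [TopologicalSpace X] (C : Set X) [CWComplex C] (n : ℕ) : Type u :=
  cocycles C n ⧸ (coboundaries C n).submoduleOf (cocycles C n)

/-- An isomorphism of CW complexes: a homeomorphism that carries the open cells of each dimension
bijectively to the open cells of the same dimension. -/
structure CellularHomeo {X : Type u} {Y : Type v} [TopologicalSpace X] [TopologicalSpace Y]
    (C : Set X) (D : Set Y) [CWComplex C] [CWComplex D] where
  /-- The homeomorphism of the underlying spaces. -/
  toHomeomorph : C ≃ₜ D
  /-- The bijection between the cells. -/
  cellEquiv (n : ℕ) : RelCWComplex.cell C n ≃ RelCWComplex.cell D n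
  /-- The homeomorphism carries each open cell to the corresponding open cell. -/
  mem_openCell_iff (n : ℕ) (i : RelCWComplex.cell C n) (p : C) :
    (toHomeomorph p : Y) ∈ RelCWComplex.openCell n (cellEquiv n i) ↔
      (p : X) ∈ RelCWComplex.openCell n i

end RegularCW

/-- The diamond space is a regular CW complex. -/
theorem DiamondSpace.isRegular (P : Type u) [PartialOrder P] [Finite P] [GradeOrder ℕ P]
    [IsThin P] : RegularCW.IsRegular (diamondSpace P) :=
  fun n i => (Function.LeftInverse.injective (DiamondSpace.cellInv_cellFun n i)).injOn

/-! Read signs additively: a balanced coloring is a mod 2 cochain on the edges whose sum around each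
diamond is 1, that is, a 1-cochain `ψ` with coboundary the constant 2-cochain 1. That constant
cochain is a cocycle because each 3-cell has evenly many 2-faces (`coboundary_one_eq_zero`), so the
vanishing of the second cohomology of `Z` supplies `ψ` (`exists_coboundary_eq`). Color an edge -1
exactly where `ψ` is nonzero. What remains is to identify the 1-faces in `Z` of a diamond's 2-cell
with the cover relations inside the diamond. `CellularHomeo.isFace_iff` moves the face relation
between `Z` and the diamond space, where `isFace_edge_iff` computes it from supports of points in
`ℝ^P`. -/

namespace RegularCW

/-! ### Faces under cellular homeomorphisms -/

section CellularHomeo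

variable {X : Type u} {Y : Type v} [TopologicalSpace X] [TopologicalSpace Y] [T2Space X] [T2Space Y]
  {C : Set X} {D : Set Y} [CWComplex C] [CWComplex D]

/-- In a Hausdorff space a closed cell is the closure of its open cell. Taking that closure inside
`C` makes closed cells visible to a homeomorphism defined only on `C`. -/
theorem mem_closedCell_iff_mem_closure (n : ℕ) (i : RelCWComplex.cell C n) (p : C) :
    (p : X) ∈ RelCWComplex.closedCell n i ↔
      p ∈ closure ((↑) ⁻¹' RelCWComplex.openCell n i : Set C) := by
  rw [closure_subtype, Subtype.image_preimage_coe,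
    inter_eq_right.2 (RelCWComplex.openCell_subset_complex n i),
    RelCWComplex.closure_openCell_eq_closedCell]

/-- An isomorphism of CW complexes carries closed cells to closed cells. -/
theorem CellularHomeo.mem_closedCell_iff (h : CellularHomeo C D) (n : ℕ)
    (i : RelCWComplex.cell C n) (p : C) :
    (h.toHomeomorph p : Y) ∈ RelCWComplex.closedCell n (h.cellEquiv n i) ↔
      (p : X) ∈ RelCWComplex.closedCell n i := by
  rw [mem_closedCell_iff_mem_closure, mem_closedCell_iff_mem_closure, ← mem_preimage,
    h.toHomeomorph.preimage_closure]
  have : h.toHomeomorph ⁻¹' ((↑) ⁻¹' RelCWComplex.openCell n (h.cellEquiv n i) : Set D) =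
      ((↑) ⁻¹' RelCWComplex.openCell n i : Set C) := by
    ext q
    exact h.mem_openCell_iff n i q
  rw [this]

/-- An isomorphism of CW complexes preserves and reflects the face relation. -/
theorem CellularHomeo.isFace_iff (h : CellularHomeo C D) {m n : ℕ} (f : RelCWComplex.cell C m)
    (e : RelCWComplex.cell C n) :
    IsFace (h.cellEquiv m f) (h.cellEquiv n e) ↔ IsFace f e := by
  constructor
  · intro hf p hp
    have hpC := RelCWComplex.closedCell_subset_complex m f hp
    exact (h.mem_closedCell_iff n e ⟨p, hpC⟩).1 (hf ((h.mem_closedCell_iff m f ⟨p, hpC⟩).2 hp))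
  · intro hf q hq
    obtain ⟨p, hp⟩ := h.toHomeomorph.surjective
      ⟨q, RelCWComplex.closedCell_subset_complex m (h.cellEquiv m f) hq⟩
    have hpq : (h.toHomeomorph p : Y) = q := congrArg Subtype.val hp
    rw [← hpq] at hq ⊢
    exact (h.mem_closedCell_iff n e p).2 (hf ((h.mem_closedCell_iff m f p).1 hq))

end CellularHomeo

/-! ### Cocycles and parity counts -/

section Cohomology

variable {X : Type u} [TopologicalSpace X] (C : Set X) [CWComplex C]

/-- If the cohomology in degree `n + 1` vanishes, every cocycle is a coboundary. -/
theorem exists_coboundary_eq (n : ℕ) (hH : Subsingleton (Cohomology C (n + 1)))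
    (φ : RelCWComplex.cell C (n + 1) → ZMod 2) (hφ : coboundary C (n + 1) φ = 0) :
    ∃ ψ, coboundary C n ψ = φ := by
  have htop := Submodule.Quotient.subsingleton_iff.1 hH
  have hmem : (⟨φ, hφ⟩ : cocycles C (n + 1)) ∈
      (coboundaries C (n + 1)).submoduleOf (cocycles C (n + 1)) := htop ▸ Submodule.mem_top
  exact hmem

theorem coboundary_one_eq_zero (n : ℕ)
    (heven : ∀ e : RelCWComplex.cell C (n + 1), Even (faces n e).ncard) :
    coboundary C n 1 = 0 := by
  ext e
  change ∑ f ∈ (finite_faces n e).toFinset, (1 : ZMod 2) = 0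
  rw [Finset.sum_const, nsmul_one, ← ncard_eq_toFinset_card _ (finite_faces n e)]
  exact ZMod.natCast_eq_zero_iff_even.2 (heven e)

theorem coboundary_apply_eq_ncard (n : ℕ) (ψ : RelCWComplex.cell C n → ZMod 2)
    (e : RelCWComplex.cell C (n + 1)) :
    coboundary C n ψ e = ({f | IsFace f e ∧ ψ f ≠ 0}.ncard : ZMod 2) := by
  classical
  change ∑ f ∈ (finite_faces n e).toFinset, ψ f = _
  have hset : {f | IsFace f e ∧ ψ f ≠ 0} =
      (((finite_faces n e).toFinset.filter (ψ · ≠ 0) : Finset _) : Set _) := by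
    ext f
    simp [faces]
  rw [hset, ncard_coe_finset, Finset.card_eq_sum_ones, Nat.cast_sum, Finset.sum_filter]
  refine Finset.sum_congr rfl fun f _ => ?_
  -- Each value mod 2 is 0 or 1, so the sum counts the faces where the cochain is nonzero.
  have : ∀ a : ZMod 2, a = if a ≠ 0 then ((1 : ℕ) : ZMod 2) else 0 := by decide
  exact this (ψ f)

end Cohomology

end RegularCW

/-! ### Edges of a diamond as faces of its square -/

namespace DiamondSpace

variable {P : Type u} [PartialOrder P] [Finite P] [GradeOrder ℕ P] [IsThin P]

/-- The two ends and the two chosen corners are already four distinct elements, so thinness leaves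
no room for another. -/
theorem eq_corners {d : Diamond P} {z : P} (h1 : d.1.1 < z) (h2 : z < d.1.2) :
    z = (corners d).1 ∨ z = (corners d).2 := by
  obtain ⟨h0, c1, c2, c3, c4⟩ := corners_spec d
  have hsub : ({d.1.1, d.1.2, (corners d).1, (corners d).2} : Set P) ⊆ Icc d.1.1 d.1.2 := by
    rintro w (rfl | rfl | rfl | rfl)
    · exact ⟨le_rfl, d.2.1⟩
    · exact ⟨d.2.1, le_rfl⟩
    · exact ⟨c1.le, c2.le⟩
    · exact ⟨c3.le, c4.le⟩
  have hcard : ({d.1.1, d.1.2, (corners d).1, (corners d).2} : Set P).ncard = 4 := by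
    rw [ncard_insert_of_notMem, ncard_insert_of_notMem, ncard_pair h0]
    · simp [c2.lt.ne', c4.lt.ne']
    · simp [c1.lt.ne, c3.lt.ne, (c1.lt.trans c2.lt).ne]
  have heq := eq_of_subset_of_ncard_le hsub
    (by rw [hcard, IsThin.ncard_Icc _ _ d.2.1 d.2.2]) (toFinite _)
  have hz : z ∈ Icc d.1.1 d.1.2 := ⟨h1.le, h2.le⟩
  rw [← heq] at hz
  simpa [h1.ne', h2.ne] using hz

theorem cellFun_edge_subset (d : Diamond P) (e : CoverRel P) (h1 : d.1.1 ≤ e.1.1)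
    (h2 : e.1.2 ≤ d.1.2) :
    cellFun (P := P) 1 e '' Metric.closedBall 0 1 ⊆
      cellFun (P := P) 2 d '' Metric.closedBall 0 1 := by
  -- It suffices to write the edge as a path `(s, t)` in the square. The four sides are `t = -1`
  -- (bottom to first corner), `s = -1` (bottom to second), `s = 1` (first corner to top) and `t =
  -- 1` (second to top).
  have key : ∀ s t : (Fin 1 → ℝ) → ℝ,
      (∀ w ∈ Metric.closedBall (0 : Fin 1 → ℝ) 1, |s w| ≤ 1 ∧ |t w| ≤ 1) →
      (∀ w, cellFun (P := P) 1 e w =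
        squarePt d.1.1 (corners d).1 (corners d).2 d.1.2 (s w) (t w)) →
      cellFun (P := P) 1 e '' Metric.closedBall 0 1 ⊆
        cellFun (P := P) 2 d '' Metric.closedBall 0 1 := by
    rintro s t hst heq _ ⟨w, hw, rfl⟩
    refine ⟨![s w, t w], ?_, (heq w).symm⟩
    rw [mem_closedBall_zero_iff, pi_norm_le_iff_of_nonneg zero_le_one, Fin.forall_fin_two]
    exact hst w hw
  have hw0 : ∀ w ∈ Metric.closedBall (0 : Fin 1 → ℝ) 1, |w 0| ≤ 1 := by
    intro w hw
    rw [mem_closedBall_zero_iff, pi_norm_le_iff_of_nonneg zero_le_one] at hw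
    exact hw 0
  obtain ⟨⟨a, b⟩, hab⟩ := e
  dsimp only at h1 h2 hab
  have hgab : grade ℕ a + 1 = grade ℕ b := Nat.covBy_iff_add_one_eq.1 (hab.grade ℕ)
  have hgd := d.2.2
  rcases h1.eq_or_lt with hxa | hxa
  · have hby : b < d.1.2 := h2.lt_of_ne fun h => by rw [h, ← hxa] at hgab; omega
    rcases eq_corners (hxa ▸ hab.lt) hby with hb | hb
    · refine key (fun w => w 0) (fun _ => -1) (fun w hw => ⟨hw0 w hw, by simp⟩) fun w => ?_
      simp [cellFun, squarePt, edgePt, ← hxa, hb]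
    · refine key (fun _ => -1) (fun w => w 0) (fun w hw => ⟨by simp, hw0 w hw⟩) fun w => ?_
      simp [cellFun, squarePt, edgePt, ← hxa, hb]
  · have hby : b = d.1.2 := by
      by_contra hne
      have g1 := grade_strictMono (𝕆 := ℕ) hxa
      have g2 := grade_strictMono (𝕆 := ℕ) (h2.lt_of_ne hne)
      omega
    rcases eq_corners hxa (hby ▸ hab.lt) with ha | ha
    · refine key (fun _ => 1) (fun w => w 0) (fun w hw => ⟨by simp, hw0 w hw⟩) fun w => ?_
      simp [cellFun, squarePt, edgePt, hby, ha]
    · refine key (fun w => w 0) (fun _ => 1) (fun w hw => ⟨hw0 w hw, by simp⟩) fun w => ?_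
      simp [cellFun, squarePt, edgePt, hby, ha]

/-- The edges of a diamond, as faces of its `2`-cell, are the cover relations inside it. -/
theorem isFace_edge_iff (d : Diamond P) (e : CoverRel P) :
    RegularCW.IsFace (C := diamondSpace P) (m := 1) (n := 2) e d ↔
      d.1.1 ≤ e.1.1 ∧ e.1.2 ≤ d.1.2 := by
  change cellFun (P := P) 1 e '' Metric.closedBall 0 1 ⊆
      cellFun (P := P) 2 d '' Metric.closedBall 0 1 ↔ _
  refine ⟨fun h => ?_, fun h => cellFun_edge_subset d e h.1 h.2⟩
  -- The midpoint of the edge has nonzero coordinates at both ends, while every point of the square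
  -- is supported in the interval of the diamond.
  have h0 : (0 : Fin 1 → ℝ) ∈ Metric.ball 0 1 := by simp
  obtain ⟨w, -, hw⟩ := h (mem_image_of_mem _ (Metric.ball_subset_closedBall h0))
  exact ⟨(bot_le_and_le_top 2 d w _ (hw ▸ cellFun_bot_ne_zero 1 e 0 h0)).1,
    (bot_le_and_le_top 2 d w _ (hw ▸ cellFun_top_ne_zero 1 e 0 h0)).2⟩

end DiamondSpace

/-! ### Construction of the coloring -/

theorem mainTheorem7 (P : Type u) [PartialOrder P] [Finite P] [GradeOrder ℕ P] [IsThin P]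
    (Z : Type v) [TopologicalSpace Z] [T2Space Z] [CWComplex (univ : Set Z)]
    (hreg : RegularCW.IsRegular (univ : Set Z))
    (hskel : Nonempty (RegularCW.CellularHomeo (diamondSpace P)
      (RelCWComplex.skeleton (univ : Set Z) 2 : Set Z)))
    (heven : ∀ F : RelCWComplex.cell (univ : Set Z) 3, Even (RegularCW.faces 2 F).ncard)
    (hH2 : Subsingleton (RegularCW.Cohomology (univ : Set Z) 2)) :
    ∃ c : CoverRel P → ℤˣ, IsBalancedColoring P c := by
  obtain ⟨h⟩ := hskel
  obtain ⟨ψ, hψ⟩ := RegularCW.exists_coboundary_eq (univ : Set Z) 1 hH2 1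
    (RegularCW.coboundary_one_eq_zero _ 2 heven)
  let edge : CoverRel P → RelCWComplex.cell (univ : Set Z) 1 := fun e => (h.cellEquiv 1 e).1
  have hinj : Function.Injective edge :=
    Subtype.val_injective.comp (h.cellEquiv 1).injective
  have hsurj : Function.Surjective edge := by
    intro f
    -- The 2-skeleton consists of the cells of dimension less than 2 + 1, so it contains every edge
    -- of `Z`.
    have hf : f ∈ (RelCWComplex.skeleton (univ : Set Z) 2).I 1 := by
      rw [RelCWComplex.skeletonLT_I]
      change ((1 : ℕ) : ℕ∞) < 2 + 1
      norm_num
    obtain ⟨e, he⟩ := (h.cellEquiv 1).surjective ⟨f, hf⟩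
    exact ⟨e, congrArg Subtype.val he⟩
  refine ⟨fun e => if ψ (edge e) = 0 then 1 else -1, fun d => ?_⟩
  have hsum := congrFun hψ (h.cellEquiv 2 d).1
  rw [RegularCW.coboundary_apply_eq_ncard] at hsum
  rw [← ZMod.natCast_eq_one_iff_odd, ← ncard_image_of_injective _ hinj]
  -- Both sides now count 1-cells of `Z`, so it is enough that the two sets agree.
  refine Eq.trans (congrArg (fun s : Set _ => (s.ncard : ZMod 2)) ?_) hsum
  ext f
  obtain ⟨e, rfl⟩ := hsurj f
  have hface : RegularCW.IsFace (C := (univ : Set Z)) (edge e) (h.cellEquiv 2 d).1 ↔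
      d.1.1 ≤ e.1.1 ∧ e.1.2 ≤ d.1.2 :=
    -- Cells of the skeleton have the same closed cells as in `Z`, so being a face means the same in
    -- both.
    (h.isFace_iff (m := 1) (n := 2) e d).trans (DiamondSpace.isFace_edge_iff d e)
  have hc : (if ψ (edge e) = 0 then (1 : ℤˣ) else -1) = -1 ↔ ψ (edge e) ≠ 0 := by
    split_ifs with h0
    · simp [h0]
    · simpa using h0
  rw [hinj.mem_set_image]
  simp only [mem_ofPred_eq, hface, hc, and_assoc]
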